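/- Let $G=(V,E,w)$ be a finite simple undirected graph with $V=\{1,\dots,n\}$ and edge weights $w_{ij}>0$, and let $N(i)$ be the set of neighbours of $i$. On $n$ qubits let $X_i,Y_i,Z_i$ be the Pauli matrices acting on qubit $i$, put $h_{ij}=\tfrac12(I+X_iX_j-Y_iY_j+Z_iZ_j)$ and $H(G)=\sum_{(i,j)\in E}w_{ij}h_{ij}$. For $k\ge 1$ let $\mathcal P_k$ be the set of tensor products of the matrices $I,X,Y,Z$ on $n$ qubits with at most $k$ non-identity factors, and $\mathcal O_k=\mathrm{span}_{\mathbb R}\,\mathcal P_k$. Let $\mathcal M_k$ be the set of real symmetric matrices $\Gamma\in\mathbb R^{\mathcal P_k\times\mathcal P_k}$ such that * $\Gamma\succeq 0$; * $\Gamma(A,B)=\Gamma(A',B')$ whenever $A,B,A',B'\in\mathcal P_k$ and $AB=A'B'$; * $\Gamma(A,B)=-\Gamma(A',B')$ whenever $A,B,A',B'\in\mathcal P_k$ and $AB=-A'B'$; * $\Gamma(A,B)=0$ whenever $A,B\in\mathcal P_k$ and $AB$ is not Hermitian; * $\Gamma(A,A)=1$ for all $A\in\mathcal P_k$. Every $\Gamma\in\mathcal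 M_k$ determines a unique real linear functional $L:\mathcal O_{2k}\to\mathbb R$ with $L(AB)=\Gamma(A,B)$ for all $A,B\in\mathcal P_k$ with $AB\in\mathcal O_{2k}$. The level-$k$ quantum moment-SoS hierarchy is the semidefinite program of maximizing $L(H(G))$ over $\Gamma\in\mathcal M_k$. Let $\Gamma$ be any optimal solution of the level-$2$ program, $L$ its functional, and $$g_{ij}=\frac{-1+L(X_iX_j)-L(Y_iY_j)+L(Z_iZ_j)}{2},\qquad g_{ij}^+=\max\{g_{ij},0\}.$$ Then for every edge $(i,j)\in E$ (in either orientation), $$\sum_{k\in N(i)\setminus\{j\}}g_{ik}^+\le Q(g_{ij}^+),\qquad Q(x)=\begin{cases}1-x,&0\le x\le\frac12,\\[2pt] \frac12\left(\sqrt{3(1-x^2)}-x\right),&\frac12<x\le\frac{\sqrt3}{2},\\[2pt] 0,&x>\frac{\sqrt3}{2}.\end{cases}$$ -/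

import Mathlib

/-- The labels `I, X, Y, Z` of the single-qubit Pauli matrices. -/
inductive PauliLabel where
  | I | X | Y | Z
  deriving DecidableEq

instance instFintypePauliLabel : Fintype PauliLabel where
  elems := {.I, .X, .Y, .Z}
  complete a := by cases a <;> simp

/-- The four Pauli matrices on one qubit. -/
def pauliMatrix : PauliLabel → Matrix (Fin 2) (Fin 2) ℂ
  | .I => !![1, 0; 0, 1]
  | .X => !![0, 1; 1, 0]
  | .Y => !![0, -Complex.I; Complex.I, 0]
  | .Z => !![1, 0; 0, -1]

/-- Operators on `n` qubits, as matrices in the computational basis. -/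
abbrev QubitOp (n : ℕ) := Matrix (Fin n → Fin 2) (Fin n → Fin 2) ℂ

/-- A Pauli string assigns a Pauli label to each of the `n` qubits. -/
abbrev PauliString (n : ℕ) := Fin n → PauliLabel

/-- The number of non-identity terms of a Pauli string. -/
def pauliWeight {n : ℕ} (s : PauliString n) : ℕ :=
  (Finset.univ.filter fun i => s i ≠ PauliLabel.I).card

/-- The operator of a Pauli string: the tensor product of its single-qubit Pauli matrices. -/
def pauliOp {n : ℕ} (s : PauliString n) : QubitOp n :=
  Matrix.of fun a b => ∏ i, pauliMatrix (s i) (a i) (b i)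

/-- The Pauli monomials on `n` qubits with at most `k` non-identity terms. -/
abbrev PauliMonomial (n k : ℕ) := {s : PauliString n // pauliWeight s ≤ k}

/-- The real span of the Pauli monomials with at most `k` non-identity terms. -/
noncomputable abbrev pauliSpan (n k : ℕ) : Submodule ℝ (QubitOp n) :=
  Submodule.span ℝ (Set.range fun A : PauliMonomial n k => pauliOp A.1)

/-- Level-`k` moment matrices: real symmetric positive semidefinite matrices indexed by the
Pauli monomials of weight at most `k`, subject to the linear constraints of the quantum
moment-SoS hierarchy. (`Matrix.PosSemidef` includes symmetry.) -/
structure IsMomentMatrix {n k : ℕ}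
    (Γ : Matrix (PauliMonomial n k) (PauliMonomial n k) ℝ) : Prop where
  posSemidef : Γ.PosSemidef
  eq_of_mul_eq : ∀ A B A' B' : PauliMonomial n k,
    pauliOp A.1 * pauliOp B.1 = pauliOp A'.1 * pauliOp B'.1 → Γ A B = Γ A' B'
  eq_neg_of_mul_eq_neg : ∀ A B A' B' : PauliMonomial n k,
    pauliOp A.1 * pauliOp B.1 = -(pauliOp A'.1 * pauliOp B'.1) → Γ A B = -Γ A' B'
  eq_zero_of_not_isHermitian : ∀ A B : PauliMonomial n k,
    ¬ (pauliOp A.1 * pauliOp B.1).IsHermitian → Γ A B = 0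
  diag_eq_one : ∀ A : PauliMonomial n k, Γ A A = 1

/-- The set of level-`k` moment matrices on `n` qubits, as a type. -/
abbrev MomentMatrix (n k : ℕ) :=
  {Γ : Matrix (PauliMonomial n k) (PauliMonomial n k) ℝ // IsMomentMatrix Γ}

/-! Multiplication of Pauli strings, used to show that pseudo-expectations are well defined. -/

/-- The product of two Pauli labels, up to phase. -/
def labelMul : PauliLabel → PauliLabel → PauliLabel
  | .I, b => b
  | a, .I => a
  | .X, .X => .I
  | .X, .Y => .Z
  | .X, .Z => .Y
  | .Y, .X => .Z
  | .Y, .Y => .I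
  | .Y, .Z => .X
  | .Z, .X => .Y
  | .Z, .Y => .X
  | .Z, .Z => .I

/-- The phase of the product of two Pauli labels. -/
noncomputable def labelPhase : PauliLabel → PauliLabel → ℂ
  | .X, .Y => Complex.I
  | .Y, .Z => Complex.I
  | .Z, .X => Complex.I
  | .Y, .X => -Complex.I
  | .Z, .Y => -Complex.I
  | .X, .Z => -Complex.I
  | _, _ => 1

theorem pauliMatrix_mul (a b : PauliLabel) :
    pauliMatrix a * pauliMatrix b = labelPhase a b • pauliMatrix (labelMul a b) := by
  cases a <;> cases b <;> ext i j <;> fin_cases i <;> fin_cases j <;>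
    simp [pauliMatrix, labelPhase, labelMul]

theorem trace_pauliMatrix (a : PauliLabel) :
    (pauliMatrix a).trace = if a = PauliLabel.I then 2 else 0 := by
  cases a <;> simp [pauliMatrix, Matrix.trace_fin_two] <;> norm_num

theorem labelMul_eq_I (a b : PauliLabel) : labelMul a b = PauliLabel.I ↔ a = b := by
  cases a <;> cases b <;> simp [labelMul]

theorem labelMul_comm (a b : PauliLabel) : labelMul a b = labelMul b a := by
  cases a <;> cases b <;> rfl

theorem labelPhase_self (a : PauliLabel) : labelPhase a a = 1 := by
  cases a <;> rfl

theorem labelPhase_I_left (a : PauliLabel) : labelPhase .I a = 1 := by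
  cases a <;> rfl

theorem labelPhase_I_right (a : PauliLabel) : labelPhase a .I = 1 := by
  cases a <;> rfl

theorem labelMul_I_left (a : PauliLabel) : labelMul .I a = a := by
  cases a <;> rfl

theorem labelMul_I_right (a : PauliLabel) : labelMul a .I = a := by
  cases a <;> rfl

theorem labelPhase_mem (a b : PauliLabel) : labelPhase a b ^ 4 = 1 := by
  cases a <;> cases b <;> simp [labelPhase, Complex.I_pow_four, Even.neg_pow (by decide : Even 4)]

theorem pauliOp_mul {n : ℕ} (s t : PauliString n) :
    pauliOp s * pauliOp t =
      (∏ i, labelPhase (s i) (t i)) • pauliOp (fun i => labelMul (s i) (t i)) := by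
  ext a b
  simp only [pauliOp, Matrix.mul_apply, Matrix.of_apply, Matrix.smul_apply, smul_eq_mul,
    ← Finset.prod_mul_distrib]
  rw [← Fintype.piFinset_univ, ← Finset.prod_univ_sum (fun _ => Finset.univ)
    (fun i c => pauliMatrix (s i) (a i) c * pauliMatrix (t i) c (b i))]
  refine Finset.prod_congr rfl fun i _ => ?_
  have h := congrFun (congrFun (pauliMatrix_mul (s i) (t i)) (a i)) (b i)
  simpa [Matrix.mul_apply] using h

theorem trace_pauliOp {n : ℕ} (s : PauliString n) :
    (pauliOp s).trace = ∏ i, (pauliMatrix (s i)).trace := by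
  simp only [pauliOp, Matrix.trace, Matrix.diag, Matrix.of_apply]
  rw [← Fintype.piFinset_univ, ← Finset.prod_univ_sum (fun _ => Finset.univ)
    (fun i c => pauliMatrix (s i) c c)]

theorem trace_pauliOp_mul {n : ℕ} (s t : PauliString n) :
    (pauliOp s * pauliOp t).trace = if s = t then 2 ^ n else 0 := by
  rw [pauliOp_mul, Matrix.trace_smul, trace_pauliOp]
  split_ifs with h
  · subst h
    simp [labelPhase_self, trace_pauliMatrix, (labelMul_eq_I _ _).2 rfl]
  · obtain ⟨i, hi⟩ := Function.ne_iff.1 h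
    have : (∏ i, (pauliMatrix (labelMul (s i) (t i))).trace) = 0 :=
      Finset.prod_eq_zero (Finset.mem_univ i) (by
        rw [trace_pauliMatrix, if_neg]
        exact fun h' => hi ((labelMul_eq_I _ _).1 h'))
    rw [this, smul_zero]

theorem pauliOp_ne_zero {n : ℕ} (s : PauliString n) : pauliOp s ≠ 0 := by
  intro h
  have := trace_pauliOp_mul s s
  rw [h, if_pos rfl, Matrix.mul_zero, Matrix.trace_zero] at this
  exact pow_ne_zero n two_ne_zero this.symm

theorem pauliOp_linearIndependent (n k : ℕ) :
    LinearIndependent ℝ (fun A : PauliMonomial n k => pauliOp A.1) := by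
  rw [Fintype.linearIndependent_iff]
  intro c hc B
  have h := congrArg (fun M => (M * pauliOp B.1).trace) hc
  simp only [Finset.sum_mul, Matrix.trace_sum, smul_mul_assoc, Matrix.trace_smul,
    trace_pauliOp_mul, Subtype.val_inj, zero_mul, Matrix.trace_zero] at h
  simpa using h

theorem pauliOp_isHermitian {n : ℕ} (s : PauliString n) : (pauliOp s).IsHermitian := by
  ext a b
  simp only [pauliOp, Matrix.conjTranspose_apply, Matrix.of_apply, star_prod]
  refine Finset.prod_congr rfl fun i _ => ?_
  generalize s i = σ, a i = p, b i = q
  cases σ <;> fin_cases p <;> fin_cases q <;> simp [pauliMatrix]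

theorem isHermitian_of_mem_pauliSpan {n k : ℕ} {C : QubitOp n} (h : C ∈ pauliSpan n k) :
    C.IsHermitian := by
  induction h using Submodule.span_induction with
  | mem x hx => obtain ⟨A, rfl⟩ := hx; exact pauliOp_isHermitian _
  | zero => exact Matrix.isHermitian_zero
  | add x y _ _ hx hy => exact hx.add hy
  | smul r x _ hx =>
    unfold Matrix.IsHermitian at *
    rw [Matrix.conjTranspose_smul, hx, star_trivial]

theorem pauliOp_mem_pauliSpan {n k : ℕ} (s : PauliString n) (h : pauliWeight s ≤ k) :
    pauliOp s ∈ pauliSpan n k :=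
  Submodule.subset_span ⟨⟨s, h⟩, rfl⟩

theorem pauliWeight_labelMul_le {n : ℕ} (s t : PauliString n) :
    pauliWeight (fun i => labelMul (s i) (t i)) ≤ pauliWeight s + pauliWeight t := by
  classical
  unfold pauliWeight
  refine le_trans (Finset.card_le_card ?_) (Finset.card_union_le _ _)
  intro i
  simp only [Finset.mem_filter, Finset.mem_univ, true_and, Finset.mem_union]
  intro h
  by_contra! h'
  exact h (by rw [h'.1, h'.2]; rfl)

/-- Every Pauli monomial of weight at most `2k` is a product of two of weight at most `k`. -/
theorem exists_pauliOp_mul_eq {n k : ℕ} (P : PauliMonomial n (2 * k)) :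
    ∃ A B : PauliMonomial n k, pauliOp A.1 * pauliOp B.1 = pauliOp P.1 := by
  classical
  obtain ⟨s, hs⟩ := P
  set S := Finset.univ.filter fun i => s i ≠ PauliLabel.I with hS
  obtain ⟨T, hTS, hT⟩ := Finset.exists_subset_card_eq (s := S) (n := min k S.card)
    (min_le_right _ _)
  have hcard : S.card ≤ 2 * k := hs
  refine ⟨⟨fun i => if i ∈ T then s i else .I, ?_⟩, ⟨fun i => if i ∈ T then .I else s i, ?_⟩, ?_⟩
  · refine le_trans (Finset.card_le_card (t := T) ?_) (hT ▸ min_le_left _ _)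
    intro i
    simp
    tauto
  · have hsub : (Finset.univ.filter fun i => (if i ∈ T then PauliLabel.I else s i) ≠ .I) ⊆
        S \ T := by
      intro i
      simp [hS]
      tauto
    refine le_trans (Finset.card_le_card hsub) ?_
    rw [Finset.card_sdiff_of_subset hTS, hT]
    omega
  · rw [pauliOp_mul]
    have h1 : ∀ i, labelPhase (if i ∈ T then s i else .I) (if i ∈ T then .I else s i) = 1 := by
      intro i
      split_ifs
      · exact labelPhase_I_right _
      · exact labelPhase_I_left _
    have h2 : ∀ i, labelMul (if i ∈ T then s i else .I) (if i ∈ T then .I else s i) = s i := by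
      intro i
      split_ifs
      · exact labelMul_I_right _
      · exact labelMul_I_left _
    simp only [h1, h2, Finset.prod_const_one, one_smul]

/-- The constraints on a moment matrix `Γ` determine a real linear functional `L` on the span of
the Pauli monomials of weight at most `2k` with `L (A B) = Γ(A, B)`. -/
theorem existsUnique_pseudoExpectation {n k : ℕ} (Γ : MomentMatrix n k) :
    ∃! L : pauliSpan n (2 * k) →ₗ[ℝ] ℝ, ∀ (A B : PauliMonomial n k)
      (h : pauliOp A.1 * pauliOp B.1 ∈ pauliSpan n (2 * k)),
      L ⟨pauliOp A.1 * pauliOp B.1, h⟩ = Γ.1 A B := by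
  classical
  choose F F' hF using fun P : PauliMonomial n (2 * k) => exists_pauliOp_mul_eq P
  obtain ⟨b, hb⟩ : ∃ b : Module.Basis (PauliMonomial n (2 * k)) ℝ (pauliSpan n (2 * k)),
      ∀ P, (b P : QubitOp n) = pauliOp P.1 :=
    ⟨Module.Basis.span (pauliOp_linearIndependent n (2 * k)), fun P => congrArg Subtype.val
      (Module.Basis.span_apply (pauliOp_linearIndependent n (2 * k)) P)⟩
  obtain ⟨L, hL⟩ : ∃ L : pauliSpan n (2 * k) →ₗ[ℝ] ℝ, ∀ P, L (b P) = Γ.1 (F P) (F' P) :=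
    ⟨b.constr ℝ fun P => Γ.1 (F P) (F' P), fun P => b.constr_basis ℝ _ P⟩
  refine ⟨L, ?_, ?_⟩
  · intro A B h
    set c : ℂ := ∏ i, labelPhase (A.1 i) (B.1 i) with hc
    let P : PauliMonomial n (2 * k) := ⟨fun i => labelMul (A.1 i) (B.1 i),
      (pauliWeight_labelMul_le A.1 B.1).trans (by have := A.2; have := B.2; omega)⟩
    have hAB : pauliOp A.1 * pauliOp B.1 = c • pauliOp P.1 := pauliOp_mul A.1 B.1
    have hc4 : c ^ 4 = 1 := by
      rw [hc, ← Finset.prod_pow]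
      exact Finset.prod_eq_one fun i _ => labelPhase_mem _ _
    have hcreal : star c = c := by
      have hH := isHermitian_of_mem_pauliSpan h
      rw [hAB, Matrix.IsHermitian, Matrix.conjTranspose_smul, (pauliOp_isHermitian P.1).eq] at hH
      exact smul_left_injective ℂ (pauliOp_ne_zero P.1) hH
    have hc1 : c = 1 ∨ c = -1 := by
      obtain ⟨r, hr⟩ := Complex.conj_eq_iff_real.1 hcreal
      rw [hr] at hc4 ⊢
      have h4 : r ^ 4 = 1 := by exact_mod_cast hc4
      have h2 : (r - 1) * (r + 1) = 0 := by
        have : (r ^ 2 + 1) * ((r - 1) * (r + 1)) = 0 := by linear_combination h4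
        rcases mul_eq_zero.1 this with h | h
        · nlinarith [sq_nonneg r]
        · exact h
      rcases mul_eq_zero.1 h2 with h | h
      · left; exact_mod_cast (sub_eq_zero.1 h)
      · right; exact_mod_cast (eq_neg_of_add_eq_zero_left h)
    rcases hc1 with h1 | h1
    · have e : (⟨pauliOp A.1 * pauliOp B.1, h⟩ : pauliSpan n (2 * k)) = b P :=
        Subtype.ext (by simp only [hb, hAB, h1, one_smul])
      rw [e, hL]
      exact Γ.2.eq_of_mul_eq _ _ _ _ (by rw [hF, hAB, h1, one_smul])
    · have e : (⟨pauliOp A.1 * pauliOp B.1, h⟩ : pauliSpan n (2 * k)) = -b P :=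
        Subtype.ext (by simp only [Submodule.coe_neg, hb, hAB, h1, neg_smul, one_smul])
      rw [e, map_neg, hL]
      exact (Γ.2.eq_neg_of_mul_eq_neg _ _ _ _ (by
        rw [hF, hAB, h1, neg_smul, one_smul])).symm
  · intro L' hL'
    refine b.ext fun P => ?_
    have h : pauliOp (F P).1 * pauliOp (F' P).1 ∈ pauliSpan n (2 * k) := by
      rw [hF]; exact pauliOp_mem_pauliSpan P.1 P.2
    have e : b P = ⟨pauliOp (F P).1 * pauliOp (F' P).1, h⟩ :=
      Subtype.ext (by simp only [hb, hF])
    rw [hL, e, hL']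

/-- The pseudo-expectation of a level-`k` moment matrix `Γ`: the real linear functional `L` on the
span of the Pauli monomials of weight at most `2k` with `L C = Γ(A, B)` whenever `C = A B`. -/
noncomputable def pseudoExpectation {n k : ℕ} (Γ : MomentMatrix n k) :
    pauliSpan n (2 * k) →ₗ[ℝ] ℝ :=
  (existsUnique_pseudoExpectation Γ).choose

theorem pseudoExpectation_mul {n k : ℕ} (Γ : MomentMatrix n k) (A B : PauliMonomial n k)
    (h : pauliOp A.1 * pauliOp B.1 ∈ pauliSpan n (2 * k)) :
    pseudoExpectation Γ ⟨pauliOp A.1 * pauliOp B.1, h⟩ = Γ.1 A B :=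
  (existsUnique_pseudoExpectation Γ).choose_spec.1 A B h

/-- The Pauli matrix `σ` acting on qubit `i` (and the identity on all other qubits). -/
def siteOp {n : ℕ} (σ : PauliLabel) (i : Fin n) : QubitOp n :=
  pauliOp (Function.update (fun _ => PauliLabel.I) i σ)

theorem siteOp_mul {n : ℕ} (σ : PauliLabel) (i j : Fin n) :
    siteOp σ i * siteOp σ j =
      pauliOp (fun l => labelMul (Function.update (fun _ => PauliLabel.I) i σ l)
        (Function.update (fun _ => PauliLabel.I) j σ l)) := by
  rw [siteOp, siteOp, pauliOp_mul, Finset.prod_eq_one, one_smul]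
  intro l _
  simp only [Function.update_apply]
  split_ifs <;> simp [labelPhase_self, labelPhase_I_left, labelPhase_I_right]

theorem siteOp_mul_comm {n : ℕ} (σ : PauliLabel) (i j : Fin n) :
    siteOp σ i * siteOp σ j = siteOp σ j * siteOp σ i := by
  rw [siteOp_mul, siteOp_mul]
  simp only [labelMul_comm]

theorem pauliWeight_update_le {n : ℕ} (σ : PauliLabel) (i : Fin n) :
    pauliWeight (Function.update (fun _ => PauliLabel.I) i σ) ≤ 1 := by
  unfold pauliWeight
  refine le_trans (Finset.card_le_card (t := {i}) ?_) (by simp)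
  intro l
  simp only [Finset.mem_filter, Finset.mem_univ, true_and, Finset.mem_singleton,
    Function.update_apply]
  split_ifs <;> simp_all

theorem siteOp_mul_mem {n m : ℕ} (hm : 2 ≤ m) (σ : PauliLabel) (i j : Fin n) :
    siteOp σ i * siteOp σ j ∈ pauliSpan n m := by
  rw [siteOp_mul]
  refine pauliOp_mem_pauliSpan _ ((pauliWeight_labelMul_le _ _).trans ?_)
  have := pauliWeight_update_le σ i
  have := pauliWeight_update_le σ j
  omega

theorem one_mem_pauliSpan (n m : ℕ) : (1 : QubitOp n) ∈ pauliSpan n m := by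
  have h : pauliOp (fun _ : Fin n => PauliLabel.I) = 1 := by
    ext a b
    simp only [pauliOp, Matrix.of_apply, Matrix.one_apply]
    split_ifs with hab
    · subst hab
      refine Finset.prod_eq_one fun i _ => ?_
      generalize a i = p
      fin_cases p <;> simp [pauliMatrix]
    · obtain ⟨i, hi⟩ := Function.ne_iff.1 hab
      refine Finset.prod_eq_zero (Finset.mem_univ i) ?_
      revert hi
      generalize a i = p, b i = q
      fin_cases p <;> fin_cases q <;> simp [pauliMatrix]
  rw [← h]
  exact pauliOp_mem_pauliSpan _ (by simp [pauliWeight])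

/-- The EPR term `h_ij = (I + X_i X_j - Y_i Y_j + Z_i Z_j) / 2` on the pair of qubits `i, j`. -/
noncomputable def eprTerm {n : ℕ} (i j : Fin n) : QubitOp n :=
  (1 / 2 : ℝ) • (1 + siteOp .X i * siteOp .X j - siteOp .Y i * siteOp .Y j
    + siteOp .Z i * siteOp .Z j)

theorem eprTerm_comm {n : ℕ} (i j : Fin n) : eprTerm i j = eprTerm j i := by
  rw [eprTerm, eprTerm, siteOp_mul_comm .X, siteOp_mul_comm .Y, siteOp_mul_comm .Z]

theorem eprTerm_mem {n m : ℕ} (hm : 2 ≤ m) (i j : Fin n) : eprTerm i j ∈ pauliSpan n m :=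
  Submodule.smul_mem _ _ (Submodule.add_mem _ (Submodule.sub_mem _ (Submodule.add_mem _
    (one_mem_pauliSpan n m) (siteOp_mul_mem hm .X i j)) (siteOp_mul_mem hm .Y i j))
    (siteOp_mul_mem hm .Z i j))

/-- The EPR Hamiltonian `H(G) = ∑_{(i,j) ∈ E} w_ij h_ij` of a weighted graph; each undirected edge
is counted once. -/
noncomputable def eprHamiltonian {n : ℕ} (G : SimpleGraph (Fin n)) [DecidableRel G.Adj]
    (w : G.edgeSet → ℝ) : QubitOp n :=
  ∑ e : G.edgeSet, w e • Sym2.lift ⟨eprTerm, eprTerm_comm⟩ e.1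

theorem eprHamiltonian_mem {n m : ℕ} (hm : 2 ≤ m) (G : SimpleGraph (Fin n)) [DecidableRel G.Adj]
    (w : G.edgeSet → ℝ) : eprHamiltonian G w ∈ pauliSpan n m := by
  refine Submodule.sum_mem _ fun e _ => Submodule.smul_mem _ _ ?_
  obtain ⟨e, he⟩ := e
  induction e with
  | _ i j => exact eprTerm_mem hm i j

theorem two_le_two_mul {k : ℕ} (hk : 1 ≤ k) : 2 ≤ 2 * k := by omega

/-- The objective `L(H(G))` of the level-`k` semidefinite program at the moment matrix `Γ`. -/
noncomputable def sdpObjective {n k : ℕ} (hk : 1 ≤ k) (G : SimpleGraph (Fin n))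
    [DecidableRel G.Adj] (w : G.edgeSet → ℝ) (Γ : MomentMatrix n k) : ℝ :=
  pseudoExpectation Γ ⟨eprHamiltonian G w, eprHamiltonian_mem (two_le_two_mul hk) G w⟩

/-- `Γ` is an output of the level-`k` quantum moment-SoS hierarchy for the EPR problem on `(G, w)`:
it maximizes `L(H(G))` over all level-`k` moment matrices. -/
def IsSDPOutput {n k : ℕ} (hk : 1 ≤ k) (G : SimpleGraph (Fin n))
    [DecidableRel G.Adj] (w : G.edgeSet → ℝ) (Γ : MomentMatrix n k) : Prop :=
  ∀ Γ' : MomentMatrix n k, sdpObjective hk G w Γ' ≤ sdpObjective hk G w Γ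

/-- The pseudo-expectation `L(σ_i σ_j)` of a two-qubit Pauli correlation. -/
noncomputable def pauliCorrelation {n k : ℕ} (hk : 1 ≤ k) (Γ : MomentMatrix n k)
    (σ : PauliLabel) (i j : Fin n) : ℝ :=
  pseudoExpectation Γ ⟨siteOp σ i * siteOp σ j, siteOp_mul_mem (two_le_two_mul hk) σ i j⟩

/-- The edge value `g_ij = (-1 + L(X_i X_j) - L(Y_i Y_j) + L(Z_i Z_j)) / 2`. -/
noncomputable def edgeValue {n k : ℕ} (hk : 1 ≤ k) (Γ : MomentMatrix n k) (i j : Fin n) : ℝ :=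
  (-1 + pauliCorrelation hk Γ .X i j - pauliCorrelation hk Γ .Y i j
    + pauliCorrelation hk Γ .Z i j) / 2

/-- The positive part `g_ij⁺ = max {g_ij, 0}` of the edge value. -/
noncomputable def edgeValuePos {n k : ℕ} (hk : 1 ≤ k) (Γ : MomentMatrix n k) (i j : Fin n) : ℝ :=
  max (edgeValue hk Γ i j) 0

/-- The bound `Q` on `[0, 1]`: `1 - x` on `[0, 1/2]`, `(√(3 (1 - x²)) - x) / 2` on
`(1/2, √3/2]`, and `0` on `(√3/2, 1]`. -/
noncomputable def moeBound (x : ℝ) : ℝ :=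
  if x ≤ 1 / 2 then 1 - x
  else if x ≤ Real.sqrt 3 / 2 then (Real.sqrt (3 * (1 - x ^ 2)) - x) / 2
  else 0

/-! Only edges at the fixed vertex `i` occur. Conjugating qubit `i` alone by `Y` turns `-XX+YY-ZZ`
on each of them into a Heisenberg interaction `b_k = eprBond i k`, with `L(b_k) = -(1 + 2 g_ik)`, so
the claim becomes monogamy of singlets on a star. With `t_kl = siteBond k l`, the algebra needed is
`b_k² = 3 - 2 b_k`, `b_k b_l + b_l b_k = 2 t_kl` and `L(t_kl) ≤ 1`. All operators squared have
weight at most two, so level 2 makes their squares nonnegative.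

Let `x = g_ij`, let `S` be the set of other neighbours with positive value, and let `y` be the sum
of those values. For a sum `B` of `d` bonds, `L(B²) ≤ d(d+2) - 2 L(B)`; with `L(B)² ≤ L(B²)` this
gives the star bound: values at `i` sum to at most 1. That settles `x ≤ 1/2`.

For `x > 1/2`, the middle branch of `Q` is the ellipse `x² + xy + y² = 3/4` solved for `y`. If `S`
is one vertex, the ellipse bound comes from the moments of three qubits (`triangle_nonneg`). If `S`
has at least two, it comes from a 2×2 covariance bound for `b_j` and the sum over `S`
(`quadratic_nonneg`), followed by the real inequality `sq_add_mul_add_sq_le`. -/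

/-! ### Heisenberg interactions of abstract Pauli triples -/

/-- The Pauli algebra relations for three elements of a complex algebra. -/
structure IsPauliTriple {R : Type*} [Ring R] [Algebra ℂ R] (a : Fin 3 → R) : Prop where
  sq_eq_one : ∀ m, a m * a m = 1
  mul_01 : a 0 * a 1 = Complex.I • a 2
  mul_12 : a 1 * a 2 = Complex.I • a 0
  mul_20 : a 2 * a 0 = Complex.I • a 1
  mul_10 : a 1 * a 0 = -Complex.I • a 2
  mul_21 : a 2 * a 1 = -Complex.I • a 0
  mul_02 : a 0 * a 2 = -Complex.I • a 1

/-- The Heisenberg interaction of two triples. -/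
def heisenberg {R : Type*} [Ring R] (a b : Fin 3 → R) : R :=
  a 0 * b 0 + a 1 * b 1 + a 2 * b 2

section Heisenberg

variable {R : Type*} [Ring R] {a b c : Fin 3 → R}

theorem heisenberg_comm (hab : ∀ m n, Commute (a m) (b n)) :
    heisenberg a b = heisenberg b a := by
  simp only [heisenberg, (hab _ _).eq]

theorem Commute.mul_mul_mul_comm_of {p q r s : R} (h : Commute q r) :
    p * q * (r * s) = p * r * (q * s) := by
  rw [mul_assoc, ← mul_assoc q, h.eq, mul_assoc r, ← mul_assoc]

variable [Algebra ℂ R]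

/-- The three diagonal terms give 3. In an off-diagonal term both triples contribute a factor `±i`
of the same sign, so each product is minus a term of the interaction. -/
theorem heisenberg_mul_self (ha : IsPauliTriple a) (hb : IsPauliTriple b)
    (hab : ∀ m n, Commute (a m) (b n)) :
    heisenberg a b * heisenberg a b = 3 - 2 * heisenberg a b := by
  have key : ∀ m n, a m * b m * (a n * b n) = a m * a n * (b m * b n) := fun m n =>
    (hab n m).symm.mul_mul_mul_comm_of
  simp only [heisenberg, add_mul, mul_add, key, ha.sq_eq_one, ha.mul_01, ha.mul_12, ha.mul_20,
    ha.mul_10, ha.mul_21, ha.mul_02, hb.sq_eq_one, hb.mul_01, hb.mul_12, hb.mul_20,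
    hb.mul_10, hb.mul_21, hb.mul_02, smul_mul_smul_comm, mul_one, neg_mul_neg, Complex.I_mul_I,
    neg_smul, one_smul]
  have h3 : (3 : R) = 1 + 1 + 1 := by norm_num
  rw [h3]
  noncomm_ring

/-- Distinct members of the shared triple `a` anticommute, so only the diagonal terms survive
symmetrization. -/
theorem heisenberg_anticomm (ha : IsPauliTriple a)
    (hab : ∀ m n, Commute (a m) (b n)) (hac : ∀ m n, Commute (a m) (c n))
    (hbc : ∀ m n, Commute (b m) (c n)) :
    heisenberg a b * heisenberg a c + heisenberg a c * heisenberg a b =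
      2 * heisenberg b c := by
  have key : ∀ m n, a m * b m * (a n * c n) = a m * a n * (b m * c n) := fun m n =>
    (hab n m).symm.mul_mul_mul_comm_of
  have key' : ∀ m n, a m * c m * (a n * b n) = a m * a n * (b n * c m) := fun m n => by
    rw [(hac n m).symm.mul_mul_mul_comm_of, (hbc n m).eq]
  simp only [heisenberg, add_mul, mul_add, key, key', ha.sq_eq_one, ha.mul_01, ha.mul_12,
    ha.mul_20, ha.mul_10, ha.mul_21, ha.mul_02, smul_mul_assoc, neg_smul, one_mul]
  noncomm_ring

end Heisenberg

/-! ### Pauli triples on the qubits -/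

theorem siteOp_mul_siteOp_self {n : ℕ} (σ τ : PauliLabel) (i : Fin n) :
    siteOp σ i * siteOp τ i = labelPhase σ τ • siteOp (labelMul σ τ) i := by
  rw [siteOp, siteOp, pauliOp_mul, siteOp]
  congr 1
  · rw [Finset.prod_eq_single i]
    · simp
    · intro l _ hl
      simp [hl, labelPhase_self]
    · simp
  · congr 1
    ext l
    by_cases hl : l = i
    · subst hl; simp
    · simp [hl, labelMul]

theorem commute_siteOp {n : ℕ} (σ τ : PauliLabel) {i j : Fin n} (hij : i ≠ j) :
    Commute (siteOp σ i) (siteOp τ j) := by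
  rw [Commute, SemiconjBy, siteOp, siteOp, pauliOp_mul, pauliOp_mul]
  simp only [labelMul_comm]
  congr 1
  refine Finset.prod_congr rfl fun l _ => ?_
  by_cases hl : l = i
  · subst hl
    simp [hij, labelPhase_I_left, labelPhase_I_right]
  · simp [hl, labelPhase_I_left, labelPhase_I_right]

theorem pauliOp_I (n : ℕ) : pauliOp (fun _ : Fin n => PauliLabel.I) = 1 := by
  ext a b
  simp only [pauliOp, Matrix.of_apply, Matrix.one_apply]
  split_ifs with hab
  · subst hab
    refine Finset.prod_eq_one fun i _ => ?_
    generalize a i = p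
    fin_cases p <;> simp [pauliMatrix]
  · obtain ⟨i, hi⟩ := Function.ne_iff.1 hab
    refine Finset.prod_eq_zero (Finset.mem_univ i) ?_
    revert hi
    generalize a i = p, b i = q
    fin_cases p <;> fin_cases q <;> simp [pauliMatrix]

theorem siteOp_I {n : ℕ} (i : Fin n) : siteOp .I i = (1 : QubitOp n) := by
  rw [siteOp, Function.update_eq_self, pauliOp_I]

/-- The Pauli matrices on qubit `i`. -/
noncomputable def siteTriple {n : ℕ} (i : Fin n) : Fin 3 → QubitOp n :=
  ![siteOp .X i, siteOp .Y i, siteOp .Z i]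

/-- The Pauli matrices on qubit `i`, conjugated by `Y`. -/
noncomputable def conjTriple {n : ℕ} (i : Fin n) : Fin 3 → QubitOp n :=
  ![-siteOp .X i, siteOp .Y i, -siteOp .Z i]

theorem isPauliTriple_siteTriple {n : ℕ} (i : Fin n) : IsPauliTriple (siteTriple i) := by
  constructor
  · intro m
    fin_cases m <;> simp [siteTriple, siteOp_mul_siteOp_self, labelMul, labelPhase, siteOp_I]
  all_goals simp [siteTriple, siteOp_mul_siteOp_self, labelMul, labelPhase]

theorem isPauliTriple_conjTriple {n : ℕ} (i : Fin n) : IsPauliTriple (conjTriple i) := by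
  constructor
  · intro m
    fin_cases m <;> simp [conjTriple, siteOp_mul_siteOp_self, labelMul, labelPhase, siteOp_I]
  all_goals simp [conjTriple, siteOp_mul_siteOp_self, labelMul, labelPhase]

theorem commute_siteTriple {n : ℕ} {i j : Fin n} (hij : i ≠ j) (m m' : Fin 3) :
    Commute (siteTriple i m) (siteTriple j m') := by
  fin_cases m <;> fin_cases m' <;> exact commute_siteOp _ _ hij

theorem commute_conjTriple {n : ℕ} {i j : Fin n} (hij : i ≠ j) (m m' : Fin 3) :
    Commute (conjTriple i m) (siteTriple j m') := by
  fin_cases m <;> fin_cases m' <;> simp [conjTriple, siteTriple, commute_siteOp _ _ hij]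

/-! ### Positivity of the pseudo-expectation on squares -/

/-- An extension of the pseudo-expectation to all operators, nonnegative on squares of
operators of weight at most two. -/
theorem exists_extension_pseudoExpectation {n : ℕ} (Γ : MomentMatrix n 2) :
    ∃ L : QubitOp n →ₗ[ℝ] ℝ, (∀ C (h : C ∈ pauliSpan n (2 * 2)),
        L C = pseudoExpectation Γ ⟨C, h⟩) ∧
      ∀ A ∈ pauliSpan n 2, 0 ≤ L (A * A) := by
  obtain ⟨L, hL⟩ := LinearMap.exists_extend (pseudoExpectation Γ)
  have hL' : ∀ C (h : C ∈ pauliSpan n (2 * 2)), L C = pseudoExpectation Γ ⟨C, h⟩ := fun C h =>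
    LinearMap.congr_fun hL ⟨C, h⟩
  refine ⟨L, hL', fun M hM => ?_⟩
  -- A single product may leave the domain of the pseudo-expectation, where the extension is
  -- arbitrary; only the symmetrized value is determined.
  have key : ∀ A B : PauliMonomial n 2,
      L (pauliOp A.1 * pauliOp B.1) + L (pauliOp B.1 * pauliOp A.1) = 2 * Γ.1 A B := by
    intro A B
    have hstar : pauliOp B.1 * pauliOp A.1 =
        Matrix.conjTranspose (pauliOp A.1 * pauliOp B.1) := by
      rw [Matrix.conjTranspose_mul, (pauliOp_isHermitian _).eq, (pauliOp_isHermitian _).eq]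
    set c : ℂ := ∏ i, labelPhase (A.1 i) (B.1 i) with hc
    let P : PauliMonomial n (2 * 2) := ⟨fun i => labelMul (A.1 i) (B.1 i),
      (pauliWeight_labelMul_le A.1 B.1).trans (by have := A.2; have := B.2; omega)⟩
    have hAB : pauliOp A.1 * pauliOp B.1 = c • pauliOp P.1 := pauliOp_mul A.1 B.1
    have hc4 : c ^ 4 = 1 := by
      rw [hc, ← Finset.prod_pow]
      exact Finset.prod_eq_one fun i _ => labelPhase_mem _ _
    have hP := pauliOp_mem_pauliSpan P.1 P.2
    have hfac : (c - 1) * ((c + 1) * ((c - Complex.I) * (c + Complex.I))) = 0 := by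
      linear_combination hc4 - (c ^ 2 - 1) * Complex.I_sq
    have herm (hmem : pauliOp A.1 * pauliOp B.1 ∈ pauliSpan n (2 * 2)) :
        L (pauliOp A.1 * pauliOp B.1) + L (pauliOp B.1 * pauliOp A.1) = 2 * Γ.1 A B := by
      rw [hstar, (isHermitian_of_mem_pauliSpan hmem).eq, hL' _ hmem, pseudoExpectation_mul]
      ring
    -- For a phase `±i` the product is anti-Hermitian, so the two arbitrary values cancel, matching
    -- the zero entry of `Γ`.
    have anti (hcs : star c = -c) (hc0 : c ≠ 0) :
        L (pauliOp A.1 * pauliOp B.1) + L (pauliOp B.1 * pauliOp A.1) = 2 * Γ.1 A B := by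
      have hneg : Matrix.conjTranspose (pauliOp A.1 * pauliOp B.1) =
          -(pauliOp A.1 * pauliOp B.1) := by
        rw [hAB, Matrix.conjTranspose_smul, (pauliOp_isHermitian _).eq, hcs, neg_smul]
      rw [Γ.2.eq_zero_of_not_isHermitian, hstar, hneg, map_neg]
      · ring
      · intro hH
        have h2 := hH.eq.symm.trans hneg
        rw [hAB, ← neg_smul, ← sub_eq_zero, ← sub_smul, smul_eq_zero, sub_neg_eq_add, add_self_eq_zero]
          at h2
        exact h2.elim hc0 (pauliOp_ne_zero _)
    rcases mul_eq_zero.1 hfac with h | h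
    · exact herm (by rw [hAB, sub_eq_zero.1 h, one_smul]; exact hP)
    rcases mul_eq_zero.1 h with h | h
    · exact herm (by
        rw [hAB, eq_neg_of_add_eq_zero_left h, neg_smul, one_smul]; exact neg_mem hP)
    rcases mul_eq_zero.1 h with h | h
    · rw [sub_eq_zero.1 h] at anti
      exact anti (by simp) Complex.I_ne_zero
    · rw [eq_neg_of_add_eq_zero_left h] at anti
      exact anti (by simp) (neg_ne_zero.2 Complex.I_ne_zero)
  obtain ⟨a, rfl⟩ := (Submodule.mem_span_range_iff_exists_fun ℝ).1 hM
  have h1 : L ((∑ A, a A • pauliOp A.1) * ∑ A, a A • pauliOp A.1) =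
      ∑ A, ∑ B, a A * (a B * L (pauliOp A.1 * pauliOp B.1)) := by
    simp only [Finset.sum_mul_sum, map_sum, smul_mul_assoc, mul_smul_comm, map_smul, smul_eq_mul]
    exact Finset.sum_congr rfl fun _ _ => Finset.sum_congr rfl fun _ _ => by ring
  have h2 : ∑ A, ∑ B, a A * (a B * L (pauliOp A.1 * pauliOp B.1)) =
      ∑ A, ∑ B, a A * (a B * L (pauliOp B.1 * pauliOp A.1)) := by
    rw [Finset.sum_comm]
    exact Finset.sum_congr rfl fun _ _ => Finset.sum_congr rfl fun _ _ => by ring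
  have h3 : L ((∑ A, a A • pauliOp A.1) * ∑ A, a A • pauliOp A.1) =
      ∑ A, ∑ B, a A * (a B * Γ.1 A B) := by
    have : 2 * L ((∑ A, a A • pauliOp A.1) * ∑ A, a A • pauliOp A.1) =
        2 * ∑ A, ∑ B, a A * (a B * Γ.1 A B) := by
      rw [two_mul]
      nth_rewrite 2 [h1]
      rw [h2, h1, ← Finset.sum_add_distrib, Finset.mul_sum]
      refine Finset.sum_congr rfl fun A _ => ?_
      rw [← Finset.sum_add_distrib, Finset.mul_sum]
      refine Finset.sum_congr rfl fun B _ => ?_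
      linear_combination a A * a B * key A B
    linarith
  rw [h3]
  refine (Γ.2.posSemidef.dotProduct_mulVec_nonneg a).trans_eq ?_
  simp only [dotProduct, Matrix.mulVec, Finset.mul_sum, star_trivial]
  exact Finset.sum_congr rfl fun A _ => Finset.sum_congr rfl fun B _ => by
    rw [mul_comm (Γ.1 A B)]

/-! ### The real inequality behind the star case -/

theorem sq_add_mul_add_sq_le {x y d : ℝ} (hd : 2 ≤ d) (hx : 1 / 2 ≤ x) (hy : 0 ≤ y)
    (hxy : x + y ≤ 1)
    (h : (x * d + y + 2 * x * y) ^ 2 ≤ 4 * (1 - x ^ 2) * ((1 - y) * (d + y))) :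
    x ^ 2 + x * y + y ^ 2 ≤ 3 / 4 := by
  by_contra! hlt
  -- For `0 ≤ y ≤ 1/2` this line lies inside the ellipse, meeting it at `(1/2, 1/2)`; a point
  -- outside the ellipse lies beyond it.
  have hx' : 0.8 - 0.6 * y ≤ x := by
    by_contra! hc
    nlinarith [mul_nonneg hy (by linarith : 0 ≤ 1/2 - y), mul_pos (by linarith : 0 < 0.8 - 0.6 * y - x) (by linarith : 0 < 0.8 + 0.4 * y + x)]
  have h1 : 3 * (x * d + y + 2 * x * y) ^ 2 ≤ 4 * (2 * y + x) ^ 2 * ((1 - y) * (d + y)) := by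
    have : 0 ≤ (1 - y) * (d + y) := mul_nonneg (by linarith) (by linarith)
    nlinarith
  have hy2 : y ≤ 1 / 2 := by linarith
  -- It suffices to treat `d = 2`: by `hs` the left side grows in `d` at least as fast as the right.
  have h2 : 3 * (x * 2 + y + 2 * x * y) ^ 2 ≤ 4 * (2 * y + x) ^ 2 * ((1 - y) * (2 + y)) := by
    have hs : 4 * (2 * y + x) ^ 2 * (1 - y) ≤ 6 * x * (x * 2 + y + 2 * x * y) := by
      nlinarith [mul_nonneg hy (by linarith : 0 ≤ x - y), mul_nonneg hy (mul_nonneg hy (by linarith : 0 ≤ x - y)), mul_nonneg hy hy, mul_nonneg hy (by linarith : 0 ≤ x)]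
    nlinarith [mul_nonneg (by linarith : 0 ≤ d - 2) (by linarith : 0 ≤ x), mul_le_mul_of_nonneg_left hs (by linarith : 0 ≤ d - 2), sq_nonneg (x * (d-2))]
  -- A rational line just above the tangent at `y = 1/2` of `√(4(1-y)(2+y)/3)`, removing the square
  -- root.
  have hT : 4 * ((1 - y) * (2 + y)) ≤ 3 * (1.81 - 1.03 * y) ^ 2 := by
    nlinarith [sq_nonneg (y - 1 / 2)]
  have hN : (2 * y + x) * (1.81 - 1.03 * y) < x * 2 + y + 2 * x * y := by
    nlinarith [mul_nonneg (by linarith : 0 ≤ x - (0.8 - 0.6 * y)) (by linarith : 0 ≤ 0.19 + 3.03 * y),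
      sq_nonneg (y - 1 / 2)]
  have h3 : ((2 * y + x) * (1.81 - 1.03 * y)) ^ 2 < (x * 2 + y + 2 * x * y) ^ 2 :=
    pow_lt_pow_left₀ hN (mul_nonneg (by linarith) (by linarith)) two_ne_zero
  nlinarith [mul_le_mul_of_nonneg_left hT (sq_nonneg (2 * y + x))]

/-! ### Bonds and their relations -/

/-- The EPR interaction `-X_i X_k + Y_i Y_k - Z_i Z_k`. -/
noncomputable def eprBond {n : ℕ} (i k : Fin n) : QubitOp n :=
  heisenberg (conjTriple i) (siteTriple k)

/-- The interaction `X_k X_l + Y_k Y_l + Z_k Z_l`. -/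
noncomputable def siteBond {n : ℕ} (k l : Fin n) : QubitOp n :=
  heisenberg (siteTriple k) (siteTriple l)

theorem eprBond_mem {n : ℕ} (i k : Fin n) : eprBond i k ∈ pauliSpan n 2 := by
  simp only [eprBond, heisenberg, conjTriple, siteTriple, Matrix.cons_val, neg_mul]
  exact add_mem (add_mem (neg_mem (siteOp_mul_mem le_rfl _ _ _)) (siteOp_mul_mem le_rfl _ _ _))
    (neg_mem (siteOp_mul_mem le_rfl _ _ _))

theorem siteBond_mem {n : ℕ} (k l : Fin n) : siteBond k l ∈ pauliSpan n 2 := by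
  simp only [siteBond, heisenberg, siteTriple, Matrix.cons_val]
  exact add_mem (add_mem (siteOp_mul_mem le_rfl _ _ _) (siteOp_mul_mem le_rfl _ _ _))
    (siteOp_mul_mem le_rfl _ _ _)

theorem eprBond_mul_self {n : ℕ} {i k : Fin n} (h : i ≠ k) :
    eprBond i k * eprBond i k = 3 - 2 * eprBond i k :=
  heisenberg_mul_self (isPauliTriple_conjTriple i) (isPauliTriple_siteTriple k)
    (commute_conjTriple h)

theorem siteBond_mul_self {n : ℕ} {k l : Fin n} (h : k ≠ l) :
    siteBond k l * siteBond k l = 3 - 2 * siteBond k l :=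
  heisenberg_mul_self (isPauliTriple_siteTriple k) (isPauliTriple_siteTriple l)
    (commute_siteTriple h)

theorem eprBond_anticomm {n : ℕ} {i k l : Fin n} (hk : i ≠ k) (hl : i ≠ l) (hkl : k ≠ l) :
    eprBond i k * eprBond i l + eprBond i l * eprBond i k = 2 * siteBond k l :=
  heisenberg_anticomm (isPauliTriple_conjTriple i) (commute_conjTriple hk) (commute_conjTriple hl)
    (commute_siteTriple hkl)

/-- Here the shared qubit is `k`, hence the swap of the two triples in the first bond. -/
theorem eprBond_siteBond_anticomm {n : ℕ} {i k l : Fin n} (hk : i ≠ k) (hl : i ≠ l)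
    (hkl : k ≠ l) :
    eprBond i k * siteBond k l + siteBond k l * eprBond i k = 2 * eprBond i l := by
  rw [eprBond, heisenberg_comm (commute_conjTriple hk)]
  exact heisenberg_anticomm (isPauliTriple_siteTriple k)
    (fun m m' => (commute_conjTriple hk m' m).symm) (commute_siteTriple hkl)
    (commute_conjTriple hl)

theorem siteBond_comm {n : ℕ} {k l : Fin n} (hkl : k ≠ l) : siteBond k l = siteBond l k :=
  heisenberg_comm (commute_siteTriple hkl)

theorem map_three_sub_two_mul {R : Type*} [Ring R] [Module ℝ R] {L : R →ₗ[ℝ] ℝ} (h1 : L 1 = 1)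
    (h : R) : L (3 - 2 * h) = 3 - 2 * L h := by
  have h3 : (3 : R) = 1 + 1 + 1 := by norm_num
  rw [map_sub, two_mul, map_add, h3, map_add, map_add, h1]
  ring

theorem map_two_mul' {R : Type*} [Ring R] [Module ℝ R] (L : R →ₗ[ℝ] ℝ) (h : R) :
    L (2 * h) = 2 * L h := by
  rw [two_mul, map_add, two_mul]

/-! ### Moment inequalities -/

/-- A normalized functional, nonnegative on squares of operators of weight at most two. -/
structure IsPseudoState {n : ℕ} (L : QubitOp n →ₗ[ℝ] ℝ) : Prop where
  map_one : L 1 = 1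
  map_mul_self_nonneg : ∀ A ∈ pauliSpan n 2, 0 ≤ L (A * A)

namespace IsPseudoState

variable {n : ℕ} {L : QubitOp n →ₗ[ℝ] ℝ}

/-- With `t` the bond, `(1 - t)² = 4(1 - t)`. -/
theorem siteBond_le_one (hL : IsPseudoState L) {k l : Fin n} (h : k ≠ l) :
    L (siteBond k l) ≤ 1 := by
  have h1 := hL.map_mul_self_nonneg (1 - siteBond k l)
    (sub_mem (one_mem_pauliSpan n 2) (siteBond_mem k l))
  have h2 : (1 - siteBond k l) * (1 - siteBond k l) =
      1 - 2 * siteBond k l + siteBond k l * siteBond k l := by noncomm_ring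
  rw [h2, siteBond_mul_self h, map_add, map_sub, map_three_sub_two_mul hL.map_one, hL.map_one,
    map_two_mul'] at h1
  linarith

/-- Each square gives `3 - 2 b_k`, and each unordered pair gives `2 t_kl`, of value at most 2. -/
theorem sum_eprBond_sq_le (hL : IsPseudoState L) {i : Fin n} {S : Finset (Fin n)} (hi : i ∉ S) :
    L ((∑ k ∈ S, eprBond i k) * ∑ k ∈ S, eprBond i k) ≤
      S.card * (S.card + 2) - 2 * L (∑ k ∈ S, eprBond i k) := by
  induction S using Finset.induction_on with
  | empty => simp
  | insert j S hj ih =>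
    rw [Finset.mem_insert, not_or] at hi
    have hcross : L (eprBond i j * ∑ k ∈ S, eprBond i k + (∑ k ∈ S, eprBond i k) * eprBond i j)
        ≤ 2 * S.card := by
      rw [Finset.mul_sum, Finset.sum_mul, ← Finset.sum_add_distrib, map_sum, mul_comm,
        ← nsmul_eq_mul]
      refine Finset.sum_le_card_nsmul _ _ _ fun k hk => ?_
      have hjk : j ≠ k := fun h => hj (h ▸ hk)
      rw [eprBond_anticomm hi.1 (fun h => hi.2 (h ▸ hk)) hjk, map_two_mul']
      linarith [hL.siteBond_le_one hjk]
    have hexp : ∀ b B : QubitOp n, (b + B) * (b + B) = b * b + (b * B + B * b) + B * B := by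
      intro b B
      noncomm_ring
    rw [Finset.sum_insert hj, hexp, map_add, map_add, map_add L (eprBond i j),
      eprBond_mul_self hi.1, map_three_sub_two_mul hL.map_one, Finset.card_insert_of_notMem hj]
    push_cast
    linarith [ih hi.2]

theorem eprBond_mul_sum_add_le (hL : IsPseudoState L) {i j : Fin n} {S : Finset (Fin n)}
    (hij : i ≠ j) (hi : i ∉ S) (hj : j ∉ S) :
    L (eprBond i j * ∑ k ∈ S, eprBond i k + (∑ k ∈ S, eprBond i k) * eprBond i j)
      ≤ 2 * S.card := by
  rw [Finset.mul_sum, Finset.sum_mul, ← Finset.sum_add_distrib, map_sum, mul_comm, ← nsmul_eq_mul]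
  refine Finset.sum_le_card_nsmul _ _ _ fun k hk => ?_
  have hjk : j ≠ k := fun h => hj (h ▸ hk)
  rw [eprBond_anticomm hij (fun h => hi (h ▸ hk)) hjk, map_two_mul']
  linarith [hL.siteBond_le_one hjk]

theorem sum_eprBond_mem (i : Fin n) (S : Finset (Fin n)) :
    ∑ k ∈ S, eprBond i k ∈ pauliSpan n 2 :=
  sum_mem fun k _ => eprBond_mem i k

/-- The star bound. -/
theorem neg_sum_eprBond_le (hL : IsPseudoState L) {i : Fin n} {S : Finset (Fin n)} (hi : i ∉ S) :
    -L (∑ k ∈ S, eprBond i k) ≤ S.card + 2 := by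
  set B := ∑ k ∈ S, eprBond i k with hB
  -- The variance of `B`; with the bound on `L(B²)` it yields `(L(B) + 1)² ≤ (d + 1)²`.
  have h1 := hL.map_mul_self_nonneg (B - L B • 1)
    (sub_mem (sum_eprBond_mem i S) (Submodule.smul_mem _ _ (one_mem_pauliSpan n 2)))
  have h2 : (B - L B • 1) * (B - L B • 1) = B * B - (2 * L B) • B + (L B * L B) • 1 := by
    simp only [sub_mul, mul_sub, smul_mul_assoc, mul_smul_comm, one_mul, mul_one]
    module
  rw [h2, map_add, map_sub, map_smul, map_smul, hL.map_one, smul_eq_mul, smul_eq_mul] at h1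
  have h3 := hL.sum_eprBond_sq_le hi
  rw [← hB] at h3
  have h0 : (0 : ℝ) ≤ S.card := Nat.cast_nonneg _
  by_contra! hc
  nlinarith

/-- The bound for an edge and the remaining leaves of a star. -/
theorem quadratic_nonneg (hL : IsPseudoState L) {i j : Fin n} {S : Finset (Fin n)}
    (hij : i ≠ j) (hi : i ∉ S) (hj : j ∉ S) {q r : ℝ} (hqr : 0 ≤ q * r) :
    0 ≤ q ^ 2 * (3 - 2 * L (eprBond i j) - L (eprBond i j) ^ 2) +
      r ^ 2 * (S.card * (S.card + 2) - 2 * L (∑ k ∈ S, eprBond i k) -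
        L (∑ k ∈ S, eprBond i k) ^ 2) +
      2 * (q * r) * (S.card - L (eprBond i j) * L (∑ k ∈ S, eprBond i k)) := by
  have hB2 := hL.sum_eprBond_sq_le hi
  have hbB := hL.eprBond_mul_sum_add_le hij hi hj
  have hb2 := congrArg L (eprBond_mul_self hij)
  rw [map_three_sub_two_mul hL.map_one] at hb2
  have hbm := eprBond_mem i j
  have hBm := sum_eprBond_mem i S
  set B := ∑ k ∈ S, eprBond i k
  set b := eprBond i j
  -- Centres the operator, so its square is a variance. The cross moment is bounded only from above,
  -- which is why `q * r` must be nonnegative.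
  set p : ℝ := -(q * L b + r * L B) with hp
  have h1 := hL.map_mul_self_nonneg (p • 1 + q • b + r • B)
    (add_mem (add_mem (Submodule.smul_mem _ _ (one_mem_pauliSpan n 2))
      (Submodule.smul_mem _ _ hbm)) (Submodule.smul_mem _ _ hBm))
  have h2 : (p • 1 + q • b + r • B) * (p • 1 + q • b + r • B) =
      (p * p) • 1 + (2 * p * q) • b + (2 * p * r) • B + (q * q) • (b * b) + (r * r) • (B * B) +
        (q * r) • (b * B + B * b) := by
    simp only [add_mul, mul_add, smul_mul_assoc, mul_smul_comm, one_mul, mul_one]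
    module
  rw [h2] at h1
  simp only [map_add L, map_smul, smul_eq_mul, hL.map_one, hb2] at h1 hbB
  have h3 := mul_le_mul_of_nonneg_left hB2 (mul_self_nonneg r)
  have h4 := mul_le_mul_of_nonneg_left hbB hqr
  rw [hp] at h1
  linarith

/-- The moment inequality on three qubits. -/
theorem triangle_nonneg (hL : IsPseudoState L) {i j k : Fin n} (hij : i ≠ j) (hik : i ≠ k)
    (hjk : j ≠ k) (v₀ v₁ v₂ v₃ : ℝ) :
    0 ≤ v₀ ^ 2 + 2 * v₀ * (v₁ * L (eprBond i j) + v₂ * L (eprBond i k) + v₃ * L (siteBond j k)) +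
      v₁ ^ 2 * (3 - 2 * L (eprBond i j)) + v₂ ^ 2 * (3 - 2 * L (eprBond i k)) +
      v₃ ^ 2 * (3 - 2 * L (siteBond j k)) + 2 * (v₁ * v₂) * L (siteBond j k) +
      2 * (v₁ * v₃) * L (eprBond i k) + 2 * (v₂ * v₃) * L (eprBond i j) := by
  have h11 := congrArg L (eprBond_mul_self hij)
  have h22 := congrArg L (eprBond_mul_self hik)
  have h33 := congrArg L (siteBond_mul_self hjk)
  have h12 := congrArg L (eprBond_anticomm hij hik hjk)
  have h13 := congrArg L (eprBond_siteBond_anticomm hij hik hjk)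
  have h23 := congrArg L (eprBond_siteBond_anticomm hik hij hjk.symm)
  rw [← siteBond_comm hjk] at h23
  rw [map_three_sub_two_mul hL.map_one] at h11 h22 h33
  rw [map_two_mul'] at h12 h13 h23
  have m1 := eprBond_mem i j
  have m2 := eprBond_mem i k
  have m3 := siteBond_mem j k
  set b := eprBond i j
  set c := eprBond i k
  set t := siteBond j k
  have h1 := hL.map_mul_self_nonneg (v₀ • 1 + v₁ • b + v₂ • c + v₃ • t)
    (add_mem (add_mem (add_mem (Submodule.smul_mem _ _ (one_mem_pauliSpan n 2))
      (Submodule.smul_mem _ _ m1)) (Submodule.smul_mem _ _ m2)) (Submodule.smul_mem _ _ m3))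
  have h2 : (v₀ • 1 + v₁ • b + v₂ • c + v₃ • t) * (v₀ • 1 + v₁ • b + v₂ • c + v₃ • t) =
      (v₀ * v₀) • 1 + (2 * v₀ * v₁) • b + (2 * v₀ * v₂) • c + (2 * v₀ * v₃) • t +
        (v₁ * v₁) • (b * b) + (v₂ * v₂) • (c * c) + (v₃ * v₃) • (t * t) +
        (v₁ * v₂) • (b * c + c * b) + (v₁ * v₃) • (b * t + t * b) +
        (v₂ * v₃) • (c * t + t * c) := by
    simp only [add_mul, mul_add, smul_mul_assoc, mul_smul_comm, one_mul, mul_one]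
    module
  rw [h2] at h1
  simp only [map_add L _ ((_ : ℝ) • _), map_smul, smul_eq_mul, hL.map_one, h11, h22, h33, h12, h13, h23] at h1
  linarith

end IsPseudoState

/-! ### The ellipse bound -/

theorem sq_add_mul_add_sq_le_of_triangle {x y : ℝ} {n : ℕ} {L : QubitOp n →ₗ[ℝ] ℝ}
    (hL : IsPseudoState L) {i j k : Fin n} (hij : i ≠ j) (hik : i ≠ k) (hjk : j ≠ k)
    (hx : L (eprBond i j) = -(1 + 2 * x)) (hy : L (eprBond i k) = -(1 + 2 * y))
    (hx0 : 0 < x) (hy0 : 0 < y) : x ^ 2 + x * y + y ^ 2 ≤ 3 / 4 := by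
  have h := hL.triangle_nonneg hij hik hjk
  rw [hx, hy] at h
  obtain ⟨s, hs⟩ : ∃ s, L (siteBond j k) = 2 * (s + x + y) - 1 :=
    ⟨(L (siteBond j k) + 1) / 2 - x - y, by ring⟩
  rw [hs] at h
  -- `3 + b + c + t` is a multiple of the projector onto total spin 3/2, and `s` is half its value.
  have hs0 : 0 ≤ s := by linarith [h 3 1 1 1]
  set W : ℝ := x ^ 2 + y ^ 2 + (s + x + y) ^ 2 - s ^ 2 / 3 with hW
  have hW0 : 0 < W := by
    have : W = x ^ 2 + y ^ 2 + (x + y) ^ 2 + 2 * s * (x + y) + 2 / 3 * s ^ 2 := by rw [hW]; ring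
    rw [this]
    positivity
  have h1 : 0 ≤ W * ((3 - s) / 2 - W) := by
    -- The last three entries `v` are the values `-x`, `-y`, `s + x + y` minus their mean `s/3`, and
    -- `W = |v|²`. As `v` sums to zero, `A = v₁b + v₂c + v₃t` satisfies `A² = W(3 - b - c - t)` and
    -- `L(A) = 2W`; the first entry is `-L(A)`.
    have := h (-2 * W) (-x - s / 3) (-y - s / 3) (s + x + y - s / 3)
    rw [hW] at this ⊢
    linarith
  have h2 := nonneg_of_mul_nonneg_right h1 hW0
  nlinarith [mul_nonneg hs0 hx0.le, mul_nonneg hs0 hy0.le]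

theorem sq_add_mul_add_sq_le_of_star {x y : ℝ} {n : ℕ} {L : QubitOp n →ₗ[ℝ] ℝ}
    (hL : IsPseudoState L) {i j : Fin n} {S : Finset (Fin n)} (hij : i ≠ j) (hi : i ∉ S)
    (hj : j ∉ S) (hS : 2 ≤ S.card) (hx : L (eprBond i j) = -(1 + 2 * x))
    (hy : L (∑ k ∈ S, eprBond i k) = -(S.card + 2 * y))
    (hx0 : 1 / 2 ≤ x) (hy0 : 0 ≤ y) (hxy : x + y ≤ 1) : x ^ 2 + x * y + y ^ 2 ≤ 3 / 4 := by
  have hd : (2 : ℝ) ≤ S.card := by exact_mod_cast hS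
  have h := fun q r => hL.quadratic_nonneg (q := q) (r := r) hij hi hj
  rw [hx, hy] at h
  generalize (S.card : ℝ) = d at *
  refine sq_add_mul_add_sq_le hd hx0 hy0 hxy ?_
  set N := x * d + y + 2 * x * y with hN
  have hN0 : 0 < N := by
    have := mul_nonneg (by linarith : 0 ≤ x) hy0
    nlinarith
  have ha : 0 ≤ 1 - x ^ 2 := by nlinarith
  have hc : 0 < d + y := by linarith
  have hb : 0 ≤ (1 - y) * (d + y) := mul_nonneg (by linarith) hc.le
  have h1 : ∀ q r, 0 ≤ q * r →
      0 ≤ q ^ 2 * (1 - x ^ 2) + r ^ 2 * ((1 - y) * (d + y)) - q * r * N := by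
    intro q r hqr
    have := h q r hqr
    rw [hN]
    linarith
  by_contra! hlt
  -- The discriminant bound: `q = N`, `r = 2(1 - x²)` minimizes the form along its ray, except when
  -- `1 - x²` vanishes and the form is linear in `q`.
  rcases ha.eq_or_lt with ha0 | ha0
  · have := h1 ((1 - y) * (d + y) + 1) N (mul_nonneg (by linarith) hN0.le)
    rw [← ha0] at this
    nlinarith [mul_pos hN0 hN0]
  · have := h1 N (2 * (1 - x ^ 2)) (mul_nonneg hN0.le (by linarith))
    nlinarith

/-! ### The function `Q` and the conclusion -/

theorem moeBound_nonneg {x : ℝ} (hx : 0 ≤ x) : 0 ≤ moeBound x := by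
  unfold moeBound
  split_ifs with h1 h2
  · linarith
  · have h3 : x ^ 2 ≤ 3 / 4 := by
      have := pow_le_pow_left₀ hx h2 2
      rw [div_pow, Real.sq_sqrt (by norm_num)] at this
      linarith
    have : x ≤ Real.sqrt (3 * (1 - x ^ 2)) := Real.le_sqrt_of_sq_le (by linarith)
    linarith
  · exact le_rfl

/-- The ellipse inequality reads `(2y + x)² ≤ 3(1 - x²)`. Since `xy > 0` it also forces `x² < 3/4`,
excluding the last branch. -/
theorem le_moeBound {x y : ℝ} (hx : 1 / 2 < x) (hy : 0 < y)
    (h : x ^ 2 + x * y + y ^ 2 ≤ 3 / 4) : y ≤ moeBound x := by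
  unfold moeBound
  rw [if_neg (not_le.2 hx)]
  split_ifs with h2
  · have : 2 * y + x ≤ Real.sqrt (3 * (1 - x ^ 2)) := Real.le_sqrt_of_sq_le (by linarith)
    linarith
  · refine absurd ?_ h2
    rw [le_div_iff₀ two_pos]
    refine Real.le_sqrt_of_sq_le ?_
    have := mul_pos (one_half_pos.trans hx) hy
    nlinarith

theorem edgeValue_eq {n : ℕ} {Γ : MomentMatrix n 2} {L : QubitOp n →ₗ[ℝ] ℝ}
    (hL : ∀ C (h : C ∈ pauliSpan n (2 * 2)), L C = pseudoExpectation Γ ⟨C, h⟩) (i k : Fin n) :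
    L (eprBond i k) = -(1 + 2 * edgeValue one_le_two Γ i k) := by
  simp only [eprBond, heisenberg, conjTriple, siteTriple, Matrix.cons_val, neg_mul, map_add,
    map_neg, edgeValue, pauliCorrelation, ← hL]
  ring

theorem isPseudoState_of_extension {n : ℕ} {Γ : MomentMatrix n 2} {L : QubitOp n →ₗ[ℝ] ℝ}
    (hL : ∀ C (h : C ∈ pauliSpan n (2 * 2)), L C = pseudoExpectation Γ ⟨C, h⟩)
    (hpos : ∀ A ∈ pauliSpan n 2, 0 ≤ L (A * A)) : IsPseudoState L := by
  refine ⟨?_, hpos⟩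
  let A : PauliMonomial n 2 := ⟨fun _ => PauliLabel.I, by simp [pauliWeight]⟩
  have hA : pauliOp A.1 * pauliOp A.1 = 1 := by
    rw [pauliOp_mul]
    simp only [labelPhase_self, Finset.prod_const_one, one_smul, A, labelMul_I_left, pauliOp_I]
  have hmem : pauliOp A.1 * pauliOp A.1 ∈ pauliSpan n (2 * 2) := hA ▸ one_mem_pauliSpan n _
  rw [← hA, hL _ hmem, pseudoExpectation_mul, Γ.2.diag_eq_one]

theorem mainTheorem3 (n : ℕ) (G : SimpleGraph (Fin n)) [DecidableRel G.Adj]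
    (w : G.edgeSet → ℝ) (hw : ∀ e, 0 < w e)
    (Γ : MomentMatrix n 2) (hΓ : IsSDPOutput one_le_two G w Γ)
    (i j : Fin n) (hij : G.Adj i j) :
    ∑ l ∈ G.neighborFinset i \ {j}, edgeValuePos one_le_two Γ i l
      ≤ moeBound (edgeValuePos one_le_two Γ i j) := by
  obtain ⟨L, hLΓ, hpos⟩ := exists_extension_pseudoExpectation Γ
  have hL := isPseudoState_of_extension hLΓ hpos
  have hval := edgeValue_eq hLΓ i
  set g := edgeValue one_le_two Γ i with hg
  set S := (G.neighborFinset i \ {j}).filter fun l => 0 < g l with hS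
  have hsum : ∑ l ∈ G.neighborFinset i \ {j}, edgeValuePos one_le_two Γ i l = ∑ l ∈ S, g l := by
    rw [hS, Finset.sum_filter]
    refine Finset.sum_congr rfl fun l _ => ?_
    rw [edgeValuePos, ← hg]
    split_ifs with h
    · exact max_eq_left h.le
    · exact max_eq_right (not_lt.1 h)
  have hi : i ∉ S := by simp [hS]
  have hj : j ∉ S := by simp [hS]
  have hsumL (T : Finset (Fin n)) :
      L (∑ l ∈ T, eprBond i l) = -(T.card + 2 * ∑ l ∈ T, g l) := by
    simp [map_sum, hval, Finset.sum_add_distrib, Finset.mul_sum]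
  have star (T : Finset (Fin n)) (hT : i ∉ T) : ∑ l ∈ T, g l ≤ 1 := by
    linarith [hL.neg_sum_eprBond_le hT, hsumL T]
  rw [hsum, edgeValuePos, ← hg]
  rcases S.eq_empty_or_nonempty with h0 | hne
  · rw [h0, Finset.sum_empty]
    exact moeBound_nonneg (le_max_right _ _)
  have hy : 0 < ∑ l ∈ S, g l := Finset.sum_pos (fun l hl => (Finset.mem_filter.1 hl).2) hne
  have hxy : g j + ∑ l ∈ S, g l ≤ 1 := by
    rw [← Finset.sum_insert hj]
    exact star _ (by simp [hi, hij.ne])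
  rcases le_or_gt (g j) (1 / 2) with hx | hx
  · rw [moeBound, if_pos (max_le hx (by norm_num)), le_sub_iff_add_le, ← le_sub_iff_add_le']
    -- For `g j ≥ 0` this is the star bound on `S` with `j`; for negative `g j`, the star bound on
    -- `S` alone.
    refine max_le (by linarith) (by linarith [star S hi])
  rw [max_eq_left (by linarith)]
  refine le_moeBound hx hy ?_
  rcases Nat.lt_or_ge S.card 2 with hc | hc
  · obtain ⟨k, hk⟩ := Finset.card_eq_one.1 (le_antisymm (Nat.lt_succ_iff.1 hc) hne.card_pos)
    rw [hk, Finset.mem_singleton] at hi hj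
    rw [hk, Finset.sum_singleton] at hy ⊢
    exact sq_add_mul_add_sq_le_of_triangle hL hij.ne hi hj (hval j) (hval k) (by linarith) hy
  · exact sq_add_mul_add_sq_le_of_star hL hij.ne hi hj hc (hval j) (hsumL S) hx.le hy.le hxy
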